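/- Let $Q\subset\mathbb R^n$ be a cube with sides parallel to the axes, and let $0<r<p_0<\infty$. In what follows $R$ always denotes a cube with sides parallel to the axes. A weight on $Q$ is a function $w\in L^1(Q)$ with $w>0$ a.e. on $Q$. Let $A_1(Q)$ be the class of weights $w$ on $Q$ for which there is a finite constant $C$ with $$M_Qw(x):=\sup_{R\subset Q,\ R\ni x}\frac1{|R|}\int_R |w|\,dy\le C\,w(x)\quad\text{for a.e. }x\in Q,$$ and for $1<q<\infty$ let $A_q(Q)$ be the class of weights $w$ on $Q$ with $$\sup_{R\subset Q}\Big(\frac1{|R|}\int_R w\,dx\Big)\Big(\frac1{|R|}\int_R w^{-\frac1{q-1}}\,dx\Big)^{q-1}<\infty .$$ Let $\mathcal M^r_{A_1}(Q)$ be the set of measurable (real- or complex-valued) functions $f$ on $Q$ for which there is $w\in A_1(Q)$ with $|f|^r\le w$ a.e. on $Q$. For $0<p<\infty$ let $L^p(Q)$ be the set of measurable $f$ on $Q$ with $\int_Q|f|^p\,dx<\infty$, and, for a weight $w$ on $Q$, let $L^p_w(Q)$ be the set of measurable $f$ on $Q$ with $\int_Q|f|^p\,w\,dx<\infty$. Then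 $$\mathcal M^r_{A_1}(Q)=\bigcup_{p>r}L^p(Q)=\bigcup_{w\in A_{p_0/r}(Q)}L^{p_0}_w(Q).$$ In particular (the case $r=1$), if $1<p_0<\infty$, then a measurable function on $Q$ has an $A_1(Q)$ majorant if and only if it lies in $L^p(Q)$ for some $p>1$, and if and only if it lies in $L^{p_0}_w(Q)$ for some $w\in A_{p_0}(Q)$. -/

import Mathlib

open MeasureTheory Set
open scoped NNReal ENNReal

/-- A cube in `ℝⁿ` with sides parallel to the axes: a product of `n` compact intervals of the same
positive length `l`. -/
def IsCube {n : ℕ} (Q : Set (Fin n → ℝ)) : Prop :=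
  ∃ (a : Fin n → ℝ) (l : ℝ), 0 < l ∧ Q = Icc a (fun i => a i + l)

/-- The Hardy-Littlewood maximal operator restricted to `Ω`:
`M_Ω f(x)` is the supremum of the averages of `|f|` over the cubes `R ⊆ Ω` that contain `x`. -/
noncomputable def maximalFunction {n : ℕ} (Ω : Set (Fin n → ℝ)) (f : (Fin n → ℝ) → ℝ)
    (x : Fin n → ℝ) : ℝ≥0∞ :=
  ⨆ (R : Set (Fin n → ℝ)) (_ : IsCube R) (_ : R ⊆ Ω) (_ : x ∈ R), ⨍⁻ y in R, ‖f y‖ₑ ∂volume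

/-- A weight on the cube `Q`: a function in `L¹(Q)` that is positive (almost everywhere on `Q`).
Values outside `Q` play no role. -/
def IsWeight {n : ℕ} (Q : Set (Fin n → ℝ)) (w : (Fin n → ℝ) → ℝ) : Prop :=
  IntegrableOn w Q ∧ ∀ᵐ x ∂(volume.restrict Q), 0 < w x

/-- The class `A₁(Q)`: weights on `Q` with `M_Q w ≤ C w` a.e. on `Q` for some finite `C`. -/
def A1Weights {n : ℕ} (Q : Set (Fin n → ℝ)) : Set ((Fin n → ℝ) → ℝ) :=
  {w | IsWeight Q w ∧ ∃ C : ℝ≥0, ∀ᵐ x ∂(volume.restrict Q),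
    maximalFunction Q w x ≤ C * ENNReal.ofReal (w x)}

/-- The class `A_p(Q)`, for `1 < p < ∞`: weights on `Q` for which
`(⨍_R w) (⨍_R w ^ (1 - p'))^(p - 1)` is bounded over all cubes `R ⊆ Q`, where
`1 - p' = -1 / (p - 1)`. -/
def ApWeights {n : ℕ} (p : ℝ) (Q : Set (Fin n → ℝ)) : Set ((Fin n → ℝ) → ℝ) :=
  {w | IsWeight Q w ∧ ∃ C : ℝ≥0, ∀ R : Set (Fin n → ℝ), IsCube R → R ⊆ Q →
    (⨍⁻ x in R, ENNReal.ofReal (w x) ∂volume) *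
      (⨍⁻ x in R, ENNReal.ofReal (w x ^ (-1 / (p - 1))) ∂volume) ^ (p - 1) ≤ C}

/-- The class `𝓜^r_{A₁}(Q)` of the measurable functions `f` on `Q` for which `|f|^r` is majorized
a.e. on `Q` by an `A₁(Q)` weight. -/
def A1Majorized (𝕜 : Type*) [RCLike 𝕜] {n : ℕ} (r : ℝ) (Q : Set (Fin n → ℝ)) :
    Set ((Fin n → ℝ) → 𝕜) :=
  {f | AEStronglyMeasurable f (volume.restrict Q) ∧
    ∃ w ∈ A1Weights Q, ∀ᵐ x ∂(volume.restrict Q), ‖f x‖ ^ r ≤ w x}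

/-- The Lebesgue space `L^p(Q)`, `0 < p < ∞`, as a set of functions. -/
def LpSpace (𝕜 : Type*) [RCLike 𝕜] {n : ℕ} (p : ℝ) (Q : Set (Fin n → ℝ)) :
    Set ((Fin n → ℝ) → 𝕜) :=
  {f | MemLp f (ENNReal.ofReal p) (volume.restrict Q)}

/-- The weighted Lebesgue space `L^p_w(Q)`, `0 < p < ∞`, as a set of functions: the measurable `f`
on `Q` with `∫_Q |f|^p w < ∞`. -/
def WeightedLpSpace (𝕜 : Type*) [RCLike 𝕜] {n : ℕ} (p : ℝ) (w : (Fin n → ℝ) → ℝ)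
    (Q : Set (Fin n → ℝ)) : Set ((Fin n → ℝ) → 𝕜) :=
  {f | AEStronglyMeasurable f (volume.restrict Q) ∧
    ∫⁻ x in Q, ‖f x‖ₑ ^ p * ENNReal.ofReal (w x) < ∞}

/-!
Three inclusions `⋃ Lᵖ ⊆ 𝓜^r_{A₁} ⊆ ⋃ L^{p₀}_w ⊆ ⋃ Lᵖ` close up to the two equalities.

* If `f ∈ Lᵖ(Q)` with `p > r`, then `|f| ^ r`, extended by zero, lies in `Lˢ(ℝⁿ)` with
  `s = p / r > 1`. The maximal operator `M` is bounded there (`lintegral_cubeMaximal_rpow_le`), so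
  the Rubio de Francia series `∑ₖ 2⁻ᵏ D⁻ᵏ Mᵏ g` is a majorant `w` of `g` with `M w ≤ 2 D w`
  (`exists_cubeMaximal_majorant`), an `A₁` weight.
* If `|f| ^ r ≤ w` with `w ∈ A₁(Q)`, then, with `q = p₀ / r`, the weight `w ^ (1 - q)` is in
  `A_q(Q)` and `|f| ^ p₀ w ^ (1 - q) ≤ w` (`A1Majorized_subset_iUnion_WeightedLpSpace`).
* If `w ∈ A_q(Q)`, then the dual weight `σ = w ^ (-1 / (q - 1))` lies in `L^(1 + ε)(Q)` for some
  `ε > 0` (`exists_lintegral_dual_rpow_ne_top`), and for an exponent `t > 1` Young's inequality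
  bounds `|f| ^ (r t)` by `|f| ^ p₀ w + σ ^ (1 + ε)`.

The higher integrability of `σ` is the deep point. Hölder's inequality and the `A_q` condition show
that a subset of at most half the volume of a cube carries at most a fraction `β < 1` of its
`σ`-mass. A Calderón-Zygmund stopping argument on dyadic cubes then gives a reverse Hölder
inequality (`lintegral_dyadicAvg_rpow_le`). It is run for the dyadic averages of `σ` of a fixed
generation, where the recursion is finite; Lebesgue differentiation and Fatou's lemma pass to `σ`.
-/

/-! ### The maximal function on `ℝⁿ` and `A₁` majorants -/

/-- The uncentred maximal function of `f` on `ℝⁿ` over open cubes: balls of the sup norm are cubes.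
Using open cubes makes it lower semicontinuous, and on `ℝⁿ` no cube has to fit into a given one. -/
noncomputable def cubeMaximal {n : ℕ} (f : (Fin n → ℝ) → ℝ≥0∞) (x : Fin n → ℝ) : ℝ≥0∞ :=
  ⨆ (c : Fin n → ℝ) (ρ : ℝ) (_ : 0 < ρ) (_ : x ∈ Metric.ball c ρ),
    (∫⁻ y in Metric.ball c ρ, f y) / volume (Metric.ball c ρ)

section
variable {n : ℕ} {f g : (Fin n → ℝ) → ℝ≥0∞} {x : Fin n → ℝ}

lemma lt_cubeMaximal_iff {t : ℝ≥0∞} : t < cubeMaximal f x ↔ ∃ (c : Fin n → ℝ) (ρ : ℝ), 0 < ρ ∧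
    x ∈ Metric.ball c ρ ∧ t < (∫⁻ y in Metric.ball c ρ, f y) / volume (Metric.ball c ρ) := by
  simp only [cubeMaximal, lt_iSup_iff, exists_prop]

lemma le_cubeMaximal {c : Fin n → ℝ} {ρ : ℝ} (hρ : 0 < ρ) (hx : x ∈ Metric.ball c ρ) :
    (∫⁻ y in Metric.ball c ρ, f y) / volume (Metric.ball c ρ) ≤ cubeMaximal f x :=
  le_iSup_of_le c <| le_iSup_of_le ρ <| le_iSup_of_le hρ <| le_iSup_of_le hx le_rfl

lemma cubeMaximal_le {b : ℝ≥0∞} (h : ∀ (c : Fin n → ℝ) (ρ : ℝ), 0 < ρ → x ∈ Metric.ball c ρ →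
    (∫⁻ y in Metric.ball c ρ, f y) / volume (Metric.ball c ρ) ≤ b) : cubeMaximal f x ≤ b :=
  iSup_le fun c => iSup_le fun ρ => iSup_le fun hρ => iSup_le fun hx => h c ρ hρ hx

lemma isOpen_lt_cubeMaximal (f : (Fin n → ℝ) → ℝ≥0∞) (t : ℝ≥0∞) :
    IsOpen {x | t < cubeMaximal f x} := by
  rw [isOpen_iff_mem_nhds]
  intro x hx
  obtain ⟨c, ρ, hρ, hxc, ht⟩ := lt_cubeMaximal_iff.1 hx
  filter_upwards [Metric.isOpen_ball.mem_nhds hxc] with y hy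
  exact lt_cubeMaximal_iff.2 ⟨c, ρ, hρ, hy, ht⟩

lemma measurable_cubeMaximal (f : (Fin n → ℝ) → ℝ≥0∞) : Measurable (cubeMaximal f) :=
  measurable_of_Ioi fun t => (isOpen_lt_cubeMaximal f t).measurableSet

lemma cubeMaximal_mono (h : ∀ y, f y ≤ g y) (x : Fin n → ℝ) :
    cubeMaximal f x ≤ cubeMaximal g x :=
  cubeMaximal_le fun _ _ hρ hx =>
    (ENNReal.div_le_div_right (lintegral_mono h) _).trans (le_cubeMaximal hρ hx)

lemma cubeMaximal_const_add_le (b : ℝ≥0∞) (f : (Fin n → ℝ) → ℝ≥0∞) (x : Fin n → ℝ) :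
    cubeMaximal (fun y => b + f y) x ≤ b + cubeMaximal f x := by
  refine cubeMaximal_le fun c ρ hρ hx => ?_
  have h0 : volume (Metric.ball c ρ) ≠ 0 := (Metric.measure_ball_pos volume c hρ).ne'
  have h1 : volume (Metric.ball c ρ) ≠ ∞ := measure_ball_lt_top.ne
  rw [lintegral_add_left measurable_const, setLIntegral_const, ENNReal.add_div,
    ENNReal.mul_div_cancel_right h0 h1]
  gcongr
  exact le_cubeMaximal hρ hx

lemma cubeMaximal_const_mul_le {a : ℝ≥0∞} (ha : a ≠ ∞) (f : (Fin n → ℝ) → ℝ≥0∞)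
    (x : Fin n → ℝ) : cubeMaximal (fun y => a * f y) x ≤ a * cubeMaximal f x := by
  refine cubeMaximal_le fun c ρ hρ hx => ?_
  rw [lintegral_const_mul' _ _ ha, mul_div_assoc]
  gcongr
  exact le_cubeMaximal hρ hx

lemma cubeMaximal_tsum_le {u : ℕ → (Fin n → ℝ) → ℝ≥0∞} (hu : ∀ k, Measurable (u k))
    (x : Fin n → ℝ) : cubeMaximal (fun y => ∑' k, u k y) x ≤ ∑' k, cubeMaximal (u k) x := by
  refine cubeMaximal_le fun c ρ hρ hx => ?_
  rw [lintegral_tsum fun k => (hu k).aemeasurable, div_eq_mul_inv, ← ENNReal.tsum_mul_right]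
  exact ENNReal.tsum_le_tsum fun k => le_cubeMaximal hρ hx

lemma volume_closedBall_mul (c : Fin n → ℝ) {ρ : ℝ} (hρ : 0 < ρ) {k : ℝ} (hk : 0 ≤ k) :
    volume (Metric.closedBall c (k * ρ)) = ENNReal.ofReal k ^ n * volume (Metric.ball c ρ) := by
  rw [Real.volume_pi_closedBall _ (by positivity), Real.volume_pi_ball _ hρ,
    ← ENNReal.ofReal_pow hk, ← ENNReal.ofReal_mul (by positivity), Fintype.card_fin, ← mul_pow]
  ring_nf

/-- The weak type `(1, 1)` inequality. The Vitali covering lemma is applied to finitely many cubes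
covering a compact part of the superlevel set, so that their sides are bounded. -/
lemma mul_volume_lt_cubeMaximal_le (f : (Fin n → ℝ) → ℝ≥0∞) (t : ℝ≥0∞) :
    t * volume {x | t < cubeMaximal f x} ≤ 4 ^ n * ∫⁻ x, f x := by
  rw [(isOpen_lt_cubeMaximal f t).measure_eq_iSup_isCompact]
  simp only [ENNReal.mul_iSup]
  refine iSup_le fun K => iSup_le fun hK => iSup_le fun hKc => ?_
  have hx : ∀ x : K, ∃ (c : Fin n → ℝ) (ρ : ℝ), 0 < ρ ∧ (x : Fin n → ℝ) ∈ Metric.ball c ρ ∧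
      t < (∫⁻ y in Metric.ball c ρ, f y) / volume (Metric.ball c ρ) := fun x =>
    lt_cubeMaximal_iff.1 (hK x.2)
  choose c ρ hρ hmem ht using hx
  obtain ⟨s, hs⟩ := hKc.elim_nhds_subcover' (fun x hx => Metric.ball (c ⟨x, hx⟩) (ρ ⟨x, hx⟩))
    (fun x hx => Metric.isOpen_ball.mem_nhds (hmem ⟨x, hx⟩))
  obtain ⟨R, hR⟩ := (s.finite_toSet.image ρ).bddAbove
  obtain ⟨u, hus, hdisj, hcov⟩ := Vitali.exists_disjoint_subfamily_covering_enlargement_closedBall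
    (s : Set K) c ρ R (fun a ha => hR (mem_image_of_mem ρ ha)) 4 (by norm_num)
  have hu : u.Finite := s.finite_toSet.subset hus
  have hKu : K ⊆ ⋃ b ∈ u, Metric.closedBall (c b) (4 * ρ b) := by
    intro x hx
    obtain ⟨a, ha, hxa⟩ := mem_iUnion₂.1 (hs hx)
    obtain ⟨b, hb, hab⟩ := hcov a ha
    exact mem_iUnion₂.2 ⟨b, hb, hab (Metric.ball_subset_closedBall hxa)⟩
  lift u to Finset K using hu
  simp only [SetLike.mem_coe] at hKu
  calc t * volume K ≤ t * ∑ b ∈ u, volume (Metric.closedBall (c b) (4 * ρ b)) := by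
        gcongr
        exact (measure_mono hKu).trans (measure_biUnion_finset_le _ _)
    _ = 4 ^ n * ∑ b ∈ u, t * volume (Metric.ball (c b) (ρ b)) := by
        rw [Finset.mul_sum, Finset.mul_sum]
        refine Finset.sum_congr rfl fun b _ => ?_
        rw [volume_closedBall_mul _ (hρ b) (by norm_num), ENNReal.ofReal_ofNat]
        ring
    _ ≤ 4 ^ n * ∑ b ∈ u, ∫⁻ y in Metric.ball (c b) (ρ b), f y := by
        gcongr with b
        exact (ENNReal.le_div_iff_mul_le (.inl (Metric.measure_ball_pos volume _ (hρ b)).ne')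
          (.inl measure_ball_lt_top.ne)).1 (ht b).le
    _ = 4 ^ n * ∫⁻ y in ⋃ b ∈ u, Metric.ball (c b) (ρ b), f y := by
        rw [lintegral_biUnion_finset (hdisj.mono fun b => Metric.ball_subset_closedBall)
          fun b _ => Metric.isOpen_ball.measurableSet]
    _ ≤ 4 ^ n * ∫⁻ x, f x := by
        gcongr
        exact Measure.restrict_le_self

/-- The weak type inequality with only the large values of `f` on the right, the form that
integrates to the strong type inequality: the values below `t / 2` contribute at most `t / 2`. -/
lemma mul_volume_lt_cubeMaximal_le_setLIntegral (hf : Measurable f) (t : ℝ≥0∞) :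
    t * volume {x | t < cubeMaximal f x} ≤ 2 * 4 ^ n * ∫⁻ x in {x | t < 2 * f x}, f x := by
  set S := {x | t < 2 * f x}
  have hS : MeasurableSet S := measurableSet_lt measurable_const (hf.const_mul 2)
  rcases eq_or_ne t ∞ with rfl | ht
  · simp
  have hle : ∀ y, f y ≤ t / 2 + S.indicator f y := by
    intro y
    by_cases hy : y ∈ S
    · rw [indicator_of_mem hy]; exact le_add_self
    · rw [indicator_of_notMem hy, add_zero, ENNReal.le_div_iff_mul_le (by simp) (by simp), mul_comm]
      exact not_lt.1 hy
  have hsub : {x | t < cubeMaximal f x} ⊆ {x | t / 2 < cubeMaximal (S.indicator f) x} := by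
    intro x hx
    have h1 := lt_of_lt_of_le (show t < cubeMaximal f x from hx)
      ((cubeMaximal_mono hle x).trans (cubeMaximal_const_add_le _ _ x))
    by_contra h2
    refine absurd h1 (not_lt.2 ?_)
    calc _ ≤ t / 2 + t / 2 := by gcongr; exact not_lt.1 h2
      _ = t := ENNReal.add_halves t
  calc t * volume {x | t < cubeMaximal f x}
      = 2 * (t / 2 * volume {x | t < cubeMaximal f x}) := by
        rw [← mul_assoc, ENNReal.mul_div_cancel (by simp) (by simp)]
    _ ≤ 2 * (t / 2 * volume {x | t / 2 < cubeMaximal (S.indicator f) x}) := by gcongr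
    _ ≤ 2 * (4 ^ n * ∫⁻ x, S.indicator f x) := by
        exact mul_le_mul_right (mul_volume_lt_cubeMaximal_le _ _) _
    _ = _ := by rw [lintegral_indicator hS, mul_assoc]

lemma ae_cubeMaximal_lt_top (hf : ∫⁻ x, f x ≠ ∞) : ∀ᵐ x, cubeMaximal f x < ∞ := by
  rw [ae_iff]
  simp only [not_lt, top_le_iff]
  have h : ∀ k : ℕ, (k : ℝ≥0∞) * volume {x | cubeMaximal f x = ∞} ≤ 4 ^ n * ∫⁻ x, f x := by
    intro k
    refine le_trans ?_ (mul_volume_lt_cubeMaximal_le f k)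
    gcongr
    intro h
    simp [h]
  by_contra h0
  have : 4 ^ n * ∫⁻ x, f x < ∞ := ENNReal.mul_lt_top (by simp) hf.lt_top
  obtain ⟨k, hk⟩ := ENNReal.exists_nat_mul_gt h0 this.ne
  exact absurd (h k) (not_le.2 hk)

lemma ae_cubeMaximal_lt_top_of_rpow {s : ℝ} (hs : 1 < s) (hf : ∫⁻ x, f x ^ s ≠ ∞) :
    ∀ᵐ x, cubeMaximal f x < ∞ := by
  filter_upwards [ae_cubeMaximal_lt_top hf] with x hx
  refine lt_of_le_of_lt ((cubeMaximal_mono (g := fun y => 1 + f y ^ s) (fun y => ?_) x).trans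
    (cubeMaximal_const_add_le 1 _ x)) (by simp [hx])
  rcases le_total (f y) 1 with h | h
  · exact h.trans le_self_add
  · exact le_trans (by simpa using ENNReal.rpow_le_rpow_of_exponent_le h hs.le) le_add_self

/-- The strong type `(s, s)` inequality of Hardy and Littlewood. The layer cake formula is used for
the maximal function with respect to Lebesgue measure, and for `2 f`, with exponent `s - 1`, with
respect to the measure `f dx`. -/
theorem lintegral_cubeMaximal_rpow_le {s : ℝ} (hs : 1 < s) (hf : Measurable f)
    (hfs : ∫⁻ x, f x ^ s ≠ ∞) :
    ∫⁻ x, cubeMaximal f x ^ s ≤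
      ENNReal.ofReal (s / (s - 1) * 2 ^ s * 4 ^ n) * ∫⁻ x, f x ^ s := by
  have hs0 : 0 < s := by linarith
  have hs1 : 0 < s - 1 := by linarith
  have hMfin := ae_cubeMaximal_lt_top_of_rpow hs hfs
  have hffin : ∀ᵐ x, f x < ∞ := by
    filter_upwards [ae_lt_top (hf.pow_const s) hfs] with x hx
    exact (ENNReal.rpow_lt_top_iff_of_pos hs0).1 hx
  -- Values are turned into reals, as in the layer cake formula; this is harmless where they are
  -- finite.
  set ν := volume.withDensity f
  have hνfin : ∀ᵐ x ∂ν, f x < ∞ := (withDensity_absolutelyContinuous _ _).ae_le hffin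
  have hset : ∀ t : ℝ, 0 < t → volume {x | t < (cubeMaximal f x).toReal} ≤
      ENNReal.ofReal t⁻¹ * (2 * 4 ^ n) * ν {x | t < (2 * f x).toReal} := by
    intro t ht
    have h1 : volume {x | t < (cubeMaximal f x).toReal} ≤
        volume {x | ENNReal.ofReal t < cubeMaximal f x} := by
      refine measure_mono fun x hx => ?_
      by_contra h
      have h2 : cubeMaximal f x ≤ ENNReal.ofReal t := not_lt.1 h
      exact absurd (ENNReal.toReal_le_of_le_ofReal ht.le h2) (not_le.2 hx)
    have h3 : ν {x | ENNReal.ofReal t < 2 * f x} ≤ ν {x | t < (2 * f x).toReal} := by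
      refine measure_mono_ae ?_
      filter_upwards [hνfin] with x hx hx'
      have hx' : ENNReal.ofReal t < 2 * f x := hx'
      exact (ENNReal.ofReal_lt_iff_lt_toReal ht.le (ENNReal.mul_lt_top (by simp) hx).ne).1 hx'
    refine h1.trans (le_trans ?_ (mul_le_mul_right h3 _))
    have h4 := mul_volume_lt_cubeMaximal_le_setLIntegral hf (ENNReal.ofReal t)
    have hS : MeasurableSet {x | ENNReal.ofReal t < 2 * f x} :=
      measurableSet_lt measurable_const (hf.const_mul 2)
    rw [← withDensity_apply _ hS] at h4
    rw [mul_assoc, ENNReal.ofReal_inv_of_pos ht]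
    rwa [mul_comm, ← div_eq_mul_inv, ENNReal.le_div_iff_mul_le (.inl (by simpa)) (.inl (by simp)),
      mul_comm]
  have hL : ∫⁻ x, cubeMaximal f x ^ s =
      ENNReal.ofReal s * ∫⁻ t in Ioi (0 : ℝ), volume {x | t < (cubeMaximal f x).toReal} *
        ENNReal.ofReal (t ^ (s - 1)) := by
    rw [← lintegral_rpow_eq_lintegral_meas_lt_mul volume
      (Filter.Eventually.of_forall fun x => ENNReal.toReal_nonneg)
      (measurable_cubeMaximal f).ennreal_toReal.aemeasurable hs0]
    refine lintegral_congr_ae ?_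
    filter_upwards [hMfin] with x hx
    rw [← ENNReal.ofReal_rpow_of_nonneg ENNReal.toReal_nonneg hs0.le, ENNReal.ofReal_toReal hx.ne]
  have hR : ∫⁻ x, (2 * f x) ^ (s - 1) ∂ν =
      ENNReal.ofReal (s - 1) * ∫⁻ t in Ioi (0 : ℝ), ν {x | t < (2 * f x).toReal} *
        ENNReal.ofReal (t ^ (s - 1 - 1)) := by
    rw [← lintegral_rpow_eq_lintegral_meas_lt_mul ν
      (Filter.Eventually.of_forall fun x => ENNReal.toReal_nonneg)
      (hf.const_mul 2).ennreal_toReal.aemeasurable hs1]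
    refine lintegral_congr_ae ?_
    filter_upwards [hνfin] with x hx
    rw [← ENNReal.ofReal_rpow_of_nonneg ENNReal.toReal_nonneg hs1.le,
      ENNReal.ofReal_toReal (ENNReal.mul_lt_top (by simp) hx).ne]
  have hν : ∫⁻ x, (2 * f x) ^ (s - 1) ∂ν = ENNReal.ofReal (2 ^ (s - 1)) * ∫⁻ x, f x ^ s := by
    rw [lintegral_withDensity_eq_lintegral_mul _ hf ((hf.const_mul 2).pow_const _),
      ← lintegral_const_mul _ (hf.pow_const s)]
    refine lintegral_congr fun x => ?_
    have : f x ^ s = f x * f x ^ (s - 1) := by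
      conv_rhs => rw [← ENNReal.rpow_one (f x), ← ENNReal.rpow_mul, one_mul]
      rw [← ENNReal.rpow_add_of_nonneg _ _ zero_le_one hs1.le]
      ring_nf
    rw [Pi.mul_apply, this, ENNReal.mul_rpow_of_nonneg _ _ hs1.le,
      ← ENNReal.ofReal_rpow_of_pos (by norm_num), ENNReal.ofReal_ofNat]
    ring
  set J := ∫⁻ t in Ioi (0 : ℝ), ν {x | t < (2 * f x).toReal} * ENNReal.ofReal (t ^ (s - 1 - 1))
    with hJ
  have hJe : J = ENNReal.ofReal (s - 1)⁻¹ * (ENNReal.ofReal (2 ^ (s - 1)) * ∫⁻ x, f x ^ s) := by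
    rw [← hν, hR, ← mul_assoc, ← ENNReal.ofReal_mul (by positivity), inv_mul_cancel₀ hs1.ne']
    simp
  have hIJ : ∫⁻ t in Ioi (0 : ℝ), volume {x | t < (cubeMaximal f x).toReal} *
        ENNReal.ofReal (t ^ (s - 1)) ≤ 2 * 4 ^ n * J := by
    rw [hJ, ← lintegral_const_mul' _ _ (by finiteness)]
    refine setLIntegral_mono' measurableSet_Ioi fun t ht => ?_
    have ht : 0 < t := ht
    refine (mul_le_mul_left (hset t ht) _).trans (le_of_eq ?_)
    rw [Real.rpow_sub_one ht.ne' (s - 1), div_eq_inv_mul, ENNReal.ofReal_mul (by positivity)]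
    ring
  rw [hL]
  refine (mul_le_mul_right hIJ _).trans (le_of_eq ?_)
  have h2 : (2 : ℝ≥0∞) * 4 ^ n = ENNReal.ofReal (2 * 4 ^ n) := by
    rw [ENNReal.ofReal_mul (by norm_num), ENNReal.ofReal_pow (by norm_num)]; simp
  rw [hJe, h2, ← mul_assoc, ← mul_assoc, ← mul_assoc, ← ENNReal.ofReal_mul (by positivity),
    ← ENNReal.ofReal_mul (by positivity), ← ENNReal.ofReal_mul (by positivity)]
  congr 2
  rw [Real.rpow_sub_one (by norm_num)]
  field_simp

/-- The iterates `D⁻ᵏ Mᵏ g` of the normalized maximal operator. -/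
noncomputable def maximalIterate (D : ℝ≥0) (g : (Fin n → ℝ) → ℝ≥0∞) : ℕ → (Fin n → ℝ) → ℝ≥0∞
  | 0 => g
  | k + 1 => fun x => (D : ℝ≥0∞)⁻¹ * cubeMaximal (maximalIterate D g k) x

lemma measurable_maximalIterate (D : ℝ≥0) (hg : Measurable g) :
    ∀ k, Measurable (maximalIterate D g k)
  | 0 => hg
  | _ + 1 => (measurable_cubeMaximal _).const_mul _

/-- The Rubio de Francia algorithm: a function in `Lˢ(ℝⁿ)`, `s > 1`, has a majorant `w` with
`M w ≤ C w`, namely `∑ₖ 2⁻ᵏ D⁻ᵏ Mᵏ g` with `D` at least the norm of `M` on `Lˢ`. -/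
theorem exists_cubeMaximal_majorant {s : ℝ} (hs : 1 < s) (hg : Measurable g)
    (hgs : ∫⁻ x, g x ^ s ≠ ∞) :
    ∃ w : (Fin n → ℝ) → ℝ≥0∞, Measurable w ∧ (∀ x, g x ≤ w x) ∧
      (∃ C : ℝ≥0, ∀ x, cubeMaximal w x ≤ C * w x) ∧
      ∀ K : Set (Fin n → ℝ), volume K ≠ ∞ → ∫⁻ x in K, w x ≠ ∞ := by
  have hs0 : 0 < s := by linarith
  have hs1 : 0 < s - 1 := by linarith
  set A : ℝ := s / (s - 1) * 2 ^ s * 4 ^ n with hA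
  have hA0 : 0 ≤ A := by positivity
  -- The operator norm of `M` is at most `A ^ (1 / s)`, hence at most `D`.
  set D : ℝ≥0 := A.toNNReal + 1 with hD
  have hD0 : (D : ℝ≥0∞) ≠ 0 := by simp [hD]
  have hD1 : (1 : ℝ≥0∞) ≤ D := by simp [hD]
  have hAD : ENNReal.ofReal A ≤ (D : ℝ≥0∞) ^ s := by
    refine le_trans ?_ (ENNReal.rpow_le_rpow_of_exponent_le hD1 hs.le)
    rw [ENNReal.rpow_one, hD, ENNReal.ofReal]
    simp
  set u := maximalIterate D g
  have hum : ∀ k, Measurable (u k) := measurable_maximalIterate D hg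
  have hus : ∀ k, ∫⁻ x, u k x ^ s ≤ ∫⁻ x, g x ^ s := by
    intro k
    induction k with
    | zero => exact le_rfl
    | succ k ih =>
      calc ∫⁻ x, u (k + 1) x ^ s
          = ((D : ℝ≥0∞) ^ s)⁻¹ * ∫⁻ x, cubeMaximal (u k) x ^ s := by
            rw [← lintegral_const_mul _ ((measurable_cubeMaximal _).pow_const s)]
            refine lintegral_congr fun x => ?_
            rw [← ENNReal.inv_rpow, ← ENNReal.mul_rpow_of_nonneg _ _ hs0.le]
            rfl
        _ ≤ ((D : ℝ≥0∞) ^ s)⁻¹ * ((D : ℝ≥0∞) ^ s * ∫⁻ x, u k x ^ s) := by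
            refine mul_le_mul_right ?_ _
            refine (lintegral_cubeMaximal_rpow_le hs (hum k)
              (ih.trans_lt hgs.lt_top).ne).trans ?_
            exact mul_le_mul_left hAD _
        _ = ∫⁻ x, u k x ^ s := by
            rw [← mul_assoc, ENNReal.inv_mul_cancel, one_mul]
            · exact (ENNReal.rpow_pos (pos_iff_ne_zero.2 hD0) (by simp)).ne'
            · exact ENNReal.rpow_ne_top_of_nonneg hs0.le (by simp)
        _ ≤ _ := ih
  set w : (Fin n → ℝ) → ℝ≥0∞ := fun x => ∑' k : ℕ, (2⁻¹ : ℝ≥0∞) ^ k * u k x with hw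
  have hwm : Measurable w := Measurable.tsum fun k => (hum k).const_mul _
  refine ⟨w, hwm, fun x => ?_, ⟨2 * D, fun x => ?_⟩, fun K hK => ?_⟩
  · exact le_trans (by simp [u, maximalIterate]) (ENNReal.le_tsum 0)
  · calc cubeMaximal w x ≤ ∑' k : ℕ, cubeMaximal (fun y => (2⁻¹ : ℝ≥0∞) ^ k * u k y) x :=
          cubeMaximal_tsum_le (fun k => (hum k).const_mul _) x
      _ ≤ ∑' k : ℕ, (2 * D) * ((2⁻¹ : ℝ≥0∞) ^ (k + 1) * u (k + 1) x) := by
          refine ENNReal.tsum_le_tsum fun k => ?_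
          refine (cubeMaximal_const_mul_le (by finiteness) _ x).trans (le_of_eq ?_)
          have h1 : u (k + 1) x = (D : ℝ≥0∞)⁻¹ * cubeMaximal (u k) x := rfl
          have h2 : (2 : ℝ≥0∞) * 2⁻¹ = 1 := ENNReal.mul_inv_cancel (by simp) (by simp)
          have h3 : (D : ℝ≥0∞) * (D : ℝ≥0∞)⁻¹ = 1 := ENNReal.mul_inv_cancel hD0 (by simp)
          rw [h1, pow_succ]
          calc (2⁻¹ : ℝ≥0∞) ^ k * cubeMaximal (u k) x
              = (2 * 2⁻¹) * (D * (D : ℝ≥0∞)⁻¹) * ((2⁻¹ : ℝ≥0∞) ^ k * cubeMaximal (u k) x) := by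
                rw [h2, h3]; simp
            _ = _ := by ring
      _ ≤ (2 * D) * w x := by
          rw [ENNReal.tsum_mul_left]
          refine mul_le_mul_right ?_ _
          exact ENNReal.tsum_comp_le_tsum_of_injective (add_left_injective 1)
            (fun k : ℕ => (2⁻¹ : ℝ≥0∞) ^ k * u k x)
      _ = _ := by simp
  · rw [hw, lintegral_tsum fun k => ((hum k).const_mul _).aemeasurable]
    refine ne_top_of_le_ne_top (b := ∑' k : ℕ, (2⁻¹ : ℝ≥0∞) ^ k * (volume K + ∫⁻ x, g x ^ s)) ?_
      (ENNReal.tsum_le_tsum fun k => ?_)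
    · rw [ENNReal.tsum_mul_right, ENNReal.tsum_geometric, ENNReal.one_sub_inv_two, inv_inv]
      exact ENNReal.mul_ne_top (by simp) (ENNReal.add_ne_top.2 ⟨hK, hgs⟩)
    · rw [lintegral_const_mul _ (hum k)]
      refine mul_le_mul_right ?_ _
      calc ∫⁻ x in K, u k x ≤ ∫⁻ x in K, (1 + u k x ^ s) := by
            refine lintegral_mono fun x => ?_
            rcases le_total (u k x) 1 with h | h
            · exact h.trans le_self_add
            · exact le_trans (by simpa using ENNReal.rpow_le_rpow_of_exponent_le h hs.le)
                le_add_self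
        _ = volume K + ∫⁻ x in K, u k x ^ s := by
            rw [lintegral_add_left measurable_const]; simp
        _ ≤ volume K + ∫⁻ x, g x ^ s := by
            exact add_le_add_right
              ((lintegral_mono' Measure.restrict_le_self le_rfl).trans (hus k)) _
end

/-! ### Majorization by `A₁` weights -/

section
variable {n : ℕ} {Q : Set (Fin n → ℝ)}

lemma Icc_add_const_eq_closedBall (a : Fin n → ℝ) {l : ℝ} (hl : 0 ≤ l) :
    Icc a (fun i => a i + l) = Metric.closedBall (fun i => a i + l / 2) (l / 2) := by
  rw [closedBall_pi _ (by positivity), ← pi_univ_Icc]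
  refine pi_congr rfl fun i _ => ?_
  rw [Real.closedBall_eq_Icc]
  ring_nf

lemma IsCube.exists_eq_closedBall (hQ : IsCube Q) :
    ∃ (c : Fin n → ℝ) (ρ : ℝ), 0 < ρ ∧ Q = Metric.closedBall c ρ := by
  obtain ⟨a, l, hl, rfl⟩ := hQ
  exact ⟨_, _, half_pos hl, Icc_add_const_eq_closedBall a hl.le⟩

lemma IsCube.measurableSet (hQ : IsCube Q) : MeasurableSet Q := by
  obtain ⟨c, ρ, -, rfl⟩ := hQ.exists_eq_closedBall
  exact Metric.isClosed_closedBall.measurableSet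

lemma IsCube.volume_ne_zero (hQ : IsCube Q) : volume Q ≠ 0 := by
  obtain ⟨c, ρ, hρ, rfl⟩ := hQ.exists_eq_closedBall
  exact (Metric.measure_closedBall_pos volume c hρ).ne'

lemma IsCube.volume_ne_top (hQ : IsCube Q) : volume Q ≠ ∞ := by
  obtain ⟨c, ρ, hρ, rfl⟩ := hQ.exists_eq_closedBall
  exact measure_closedBall_lt_top.ne

lemma IsWeight.mono {w : (Fin n → ℝ) → ℝ} (hw : IsWeight Q w) {R : Set (Fin n → ℝ)} (h : R ⊆ Q) :
    IsWeight R w :=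
  ⟨hw.1.mono_set h, ae_restrict_of_ae_restrict_of_subset h hw.2⟩

lemma lintegral_ofReal_ne_zero {α : Type*} [MeasurableSpace α] {μ : Measure α}
    {w : α → ℝ} (hw : AEMeasurable w μ) (hpos : ∀ᵐ x ∂μ, 0 < w x) (hμ : μ ≠ 0) :
    ∫⁻ x, ENNReal.ofReal (w x) ∂μ ≠ 0 := by
  intro h
  rw [lintegral_eq_zero_iff' hw.ennreal_ofReal] at h
  have h2 : ∀ᵐ x ∂μ, False := by
    filter_upwards [h, hpos] with x h1 h2
    exact absurd (ENNReal.ofReal_eq_zero.1 h1) (not_le.2 h2)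
  simp only [Filter.eventually_false_iff_eq_bot, ae_eq_bot] at h2
  exact hμ h2

/-- The maximal function of a cube is dominated by that of `ℝⁿ`: a closed cube lies in the open
cube with the same centre and twice the side. -/
lemma maximalFunction_le_cubeMaximal {W : (Fin n → ℝ) → ℝ} {w : (Fin n → ℝ) → ℝ≥0∞}
    (hW : ∀ y, ‖W y‖ₑ ≤ w y) (x : Fin n → ℝ) :
    maximalFunction Q W x ≤ 2 ^ n * cubeMaximal w x := by
  refine iSup_le fun R => iSup_le fun hR => iSup_le fun _ => iSup_le fun hx => ?_
  obtain ⟨c, ρ, hρ, rfl⟩ := hR.exists_eq_closedBall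
  have hρ2 : ρ < 2 * ρ := by linarith
  have hsub := Metric.closedBall_subset_ball (x := c) hρ2
  have hvol : volume (Metric.ball c (2 * ρ)) = 2 ^ n * volume (Metric.closedBall c ρ) := by
    have h1 := volume_closedBall_mul c hρ zero_le_one
    have h2 := volume_closedBall_mul c hρ zero_le_two
    have h3 := Real.volume_pi_closedBall c (mul_nonneg zero_le_two hρ.le)
    have h4 := Real.volume_pi_ball c (mul_pos zero_lt_two hρ)
    rw [h4, ← h3, h2, ← one_mul ρ, h1]
    simp
  have h2n : (2 : ℝ≥0∞) ^ n ≠ 0 := by simp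
  rw [setLAverage_eq]
  calc (∫⁻ y in Metric.closedBall c ρ, ‖W y‖ₑ) / volume (Metric.closedBall c ρ)
      ≤ (∫⁻ y in Metric.ball c (2 * ρ), w y) / volume (Metric.closedBall c ρ) := by
        refine ENNReal.div_le_div_right ?_ _
        exact lintegral_mono' (Measure.restrict_mono hsub le_rfl) hW
    _ = 2 ^ n * ((∫⁻ y in Metric.ball c (2 * ρ), w y) / volume (Metric.ball c (2 * ρ))) := by
        rw [hvol, ← mul_div_assoc, ENNReal.mul_div_mul_left _ _ h2n (by simp)]
    _ ≤ 2 ^ n * cubeMaximal w x :=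
        mul_le_mul_right (le_cubeMaximal (by positivity) (hsub hx)) _

/-- A function in `Lᵖ(Q)`, `p > r`, has its `r`-th power majorized by an `A₁(Q)` weight: the
Rubio de Francia majorant of `max (|f| ^ r) 1` extended by zero, a function in `L^(p / r)(ℝⁿ)`. The
maximum with `1` makes the majorant positive. -/
theorem LpSpace_subset_A1Majorized (𝕜 : Type*) [RCLike 𝕜] (hQ : IsCube Q) {r p : ℝ} (hr : 0 < r)
    (hrp : r < p) : LpSpace 𝕜 p Q ⊆ A1Majorized 𝕜 r Q := by
  intro f hf
  have hfm : AEStronglyMeasurable f (volume.restrict Q) := hf.1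
  have hp : 0 < p := hr.trans hrp
  have hQm := hQ.measurableSet
  obtain ⟨F, hF, hfF⟩ := hfm
  have hfp : ∫⁻ x in Q, ‖F x‖ₑ ^ p < ∞ := by
    have h1 := (eLpNorm_lt_top_iff_lintegral_rpow_enorm_lt_top (f := f)
      (μ := volume.restrict Q) (p := ENNReal.ofReal p) (by simpa) (by simp)).1 hf.2
    rw [ENNReal.toReal_ofReal hp.le] at h1
    rwa [lintegral_congr_ae (g := fun x => ‖f x‖ₑ ^ p)]
    filter_upwards [hfF] with x hx using by rw [hx]
  set g : (Fin n → ℝ) → ℝ≥0∞ := Q.indicator fun x => max (‖F x‖ₑ ^ r) 1 with hg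
  have hgm : Measurable g :=
    ((hF.measurable.enorm.pow_const r).max measurable_const).indicator hQm
  have hs : 1 < p / r := (one_lt_div hr).2 hrp
  have hgs : ∫⁻ x, g x ^ (p / r) ≠ ∞ := by
    have h1 : ∀ x, g x ^ (p / r) ≤ Q.indicator (fun x => ‖F x‖ₑ ^ p + 1) x := by
      intro x
      by_cases hx : x ∈ Q
      · rw [hg, indicator_of_mem hx, indicator_of_mem hx]
        rcases max_choice (‖F x‖ₑ ^ r) 1 with h | h
        · rw [h, ← ENNReal.rpow_mul, mul_div_cancel₀ _ hr.ne']
          exact le_self_add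
        · rw [h, ENNReal.one_rpow]
          exact le_add_self
      · rw [hg, indicator_of_notMem hx, indicator_of_notMem hx,
          ENNReal.zero_rpow_of_pos (by positivity)]
    refine ne_top_of_le_ne_top ?_ (lintegral_mono h1)
    rw [lintegral_indicator hQm, lintegral_add_right _ measurable_const, setLIntegral_const,
      one_mul]
    exact ENNReal.add_ne_top.2 ⟨hfp.ne, hQ.volume_ne_top⟩
  obtain ⟨w, hwm, hgw, ⟨C, hC⟩, hwint⟩ := exists_cubeMaximal_majorant hs hgm hgs
  have hwQ := hwint Q hQ.volume_ne_top
  have hwfin : ∀ᵐ x ∂(volume.restrict Q), w x < ∞ := ae_lt_top hwm hwQ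
  have hge : ∀ x ∈ Q, max (‖F x‖ₑ ^ r) 1 ≤ w x := fun x hx => by
    simpa [hg, indicator_of_mem hx] using hgw x
  refine ⟨⟨F, hF, hfF⟩, fun x => (w x).toReal, ⟨⟨?_, ?_⟩, 2 ^ n * C, ?_⟩, ?_⟩
  · exact integrable_toReal_of_lintegral_ne_top hwm.aemeasurable hwQ
  · filter_upwards [hwfin, ae_restrict_mem hQm] with x hx hxQ
    exact ENNReal.toReal_pos (zero_lt_one.trans_le ((le_max_right _ _).trans (hge x hxQ))).ne' hx.ne
  · filter_upwards [hwfin] with x hx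
    rw [ENNReal.ofReal_toReal hx.ne]
    refine (maximalFunction_le_cubeMaximal (w := w) (fun y => ?_) x).trans ?_
    · rw [Real.enorm_of_nonneg ENNReal.toReal_nonneg]
      exact ENNReal.ofReal_toReal_le
    · push_cast
      rw [mul_assoc]
      exact mul_le_mul_right (hC x) _
  · filter_upwards [hwfin, ae_restrict_mem hQm, hfF] with x hx hxQ hxF
    rw [hxF, ← ENNReal.ofReal_le_iff_le_toReal hx.ne,
      ← ENNReal.ofReal_rpow_of_nonneg (norm_nonneg _) hr.le, ofReal_norm]
    exact (le_max_left _ _).trans (hge x hxQ)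

/-- If `|f| ^ r ≤ w` with `w ∈ A₁(Q)`, then with `q = p₀ / r` the weight `w ^ (1 - q)` is in
`A_q(Q)` and `|f| ^ p₀ w ^ (1 - q) ≤ w` is integrable. -/
theorem A1Majorized_subset_iUnion_WeightedLpSpace (𝕜 : Type*) [RCLike 𝕜] (hQ : IsCube Q) {r p₀ : ℝ}
    (hr : 0 < r) (hrp : r < p₀) :
    A1Majorized 𝕜 r Q ⊆ ⋃ w ∈ ApWeights (p₀ / r) Q, WeightedLpSpace 𝕜 p₀ w Q := by
  rintro f ⟨hfm, w, ⟨hwt, C, hC⟩, hfw⟩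
  have ⟨hwi, hwpos⟩ := hwt
  set q := p₀ / r with hq
  have hq1 : 0 < q - 1 := sub_pos.2 ((one_lt_div hr).2 hrp)
  have hqr : r * q = p₀ := by rw [hq]; field_simp
  have hwI : ∫⁻ x in Q, ENNReal.ofReal (w x) < ∞ := hwi.lintegral_lt_top
  have havg : ∀ R : Set (Fin n → ℝ), IsCube R → R ⊆ Q → ∀ᵐ x ∂(volume.restrict R),
      (⨍⁻ y in R, ENNReal.ofReal (w y) ∂volume) ≤ C * ENNReal.ofReal (w x) := by
    intro R hR hRQ
    filter_upwards [ae_restrict_of_ae_restrict_of_subset hRQ hC, ae_restrict_mem hR.measurableSet]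
      with x hx hxR
    refine le_trans (le_trans ?_ (le_iSup_of_le R <| le_iSup_of_le hR <| le_iSup_of_le hRQ <|
      le_iSup_of_le hxR le_rfl)) hx
    rw [setLAverage_eq, setLAverage_eq]
    exact ENNReal.div_le_div_right (lintegral_mono fun y => Real.ofReal_le_enorm _) _
  have hApos : ∀ R : Set (Fin n → ℝ), IsCube R → R ⊆ Q →
      (⨍⁻ y in R, ENNReal.ofReal (w y) ∂volume) ≠ 0 ∧
        (⨍⁻ y in R, ENNReal.ofReal (w y) ∂volume) ≠ ∞ := by
    intro R hR hRQ
    rw [setLAverage_eq]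
    refine ⟨fun h0 => ?_, ENNReal.div_ne_top
      ((lintegral_mono_set hRQ).trans_lt hwI).ne hR.volume_ne_zero⟩
    rcases ENNReal.div_eq_zero_iff.1 h0 with h | h
    · exact lintegral_ofReal_ne_zero (hwt.mono hRQ).1.1.aemeasurable (hwt.mono hRQ).2
        (by simpa using hR.volume_ne_zero) h
    · exact hR.volume_ne_top h
  -- The `A₁` condition bounds `w` below by its averages, hence `w ^ (1 - q)` above.
  have hv : ∀ R : Set (Fin n → ℝ), IsCube R → R ⊆ Q → ∀ᵐ x ∂(volume.restrict R),
      ENNReal.ofReal (w x ^ (1 - q)) ≤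
        C ^ (q - 1) * (⨍⁻ y in R, ENNReal.ofReal (w y) ∂volume) ^ (1 - q) := by
    intro R hR hRQ
    obtain ⟨h0, ht⟩ := hApos R hR hRQ
    set A := (⨍⁻ y in R, ENNReal.ofReal (w y) ∂volume)
    filter_upwards [havg R hR hRQ, ae_restrict_of_ae_restrict_of_subset hRQ hwpos] with x hx hxpos
    rw [← ENNReal.ofReal_rpow_of_pos hxpos]
    have hw0 : ENNReal.ofReal (w x) ≠ 0 := by simpa
    have h1 : A ^ (q - 1) ≤ C ^ (q - 1) * ENNReal.ofReal (w x) ^ (q - 1) := by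
      rw [← ENNReal.mul_rpow_of_nonneg _ _ hq1.le]
      exact ENNReal.rpow_le_rpow hx hq1.le
    have e : ∀ y : ℝ≥0∞, y ^ (1 - q) = (y ^ (q - 1))⁻¹ := fun y => by
      rw [← ENNReal.rpow_neg]; ring_nf
    rw [e, e, ← div_eq_mul_inv, ENNReal.le_div_iff_mul_le
      (.inl (ENNReal.rpow_pos (pos_iff_ne_zero.2 h0) ht).ne')
      (.inl (ENNReal.rpow_ne_top_of_nonneg hq1.le ht)), mul_comm, ← div_eq_mul_inv]
    exact ENNReal.div_le_of_le_mul h1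
  refine mem_iUnion₂.2 ⟨fun x => w x ^ (1 - q), ⟨⟨⟨?_, ?_⟩, ?_⟩, C ^ (q - 1), ?_⟩, hfm, ?_⟩
  · exact (hwi.1.aemeasurable.pow_const _).aestronglyMeasurable
  · rw [hasFiniteIntegral_iff_ofReal]
    · obtain ⟨h0, ht⟩ := hApos Q hQ subset_rfl
      refine (lintegral_mono_ae (hv Q hQ subset_rfl)).trans_lt ?_
      rw [setLIntegral_const]
      refine ENNReal.mul_lt_top (ENNReal.mul_lt_top ?_ ?_) hQ.volume_ne_top.lt_top
      · exact ENNReal.rpow_lt_top_of_nonneg hq1.le (by simp)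
      · exact (ENNReal.rpow_ne_top_of_ne_zero h0 ht).lt_top
    · filter_upwards [hwpos] with x hx using Real.rpow_nonneg hx.le _
  · filter_upwards [hwpos] with x hx using Real.rpow_pos_of_pos hx _
  · intro R hR hRQ
    obtain ⟨h0, ht⟩ := hApos R hR hRQ
    have h1 : (⨍⁻ x in R, ENNReal.ofReal ((w x ^ (1 - q)) ^ (-1 / (q - 1))) ∂volume) =
        (⨍⁻ x in R, ENNReal.ofReal (w x) ∂volume) := by
      rw [setLAverage_eq, setLAverage_eq]
      congr 1
      refine lintegral_congr_ae ?_
      filter_upwards [ae_restrict_of_ae_restrict_of_subset hRQ hwpos] with x hx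
      rw [← Real.rpow_mul hx.le]
      have : (1 - q) * (-1 / (q - 1)) = 1 := by field_simp; ring
      rw [this, Real.rpow_one]
    rw [h1]
    set A := (⨍⁻ y in R, ENNReal.ofReal (w y) ∂volume)
    have h2 : (⨍⁻ x in R, ENNReal.ofReal (w x ^ (1 - q)) ∂volume) ≤ C ^ (q - 1) * A ^ (1 - q) := by
      rw [setLAverage_eq]
      refine ENNReal.div_le_of_le_mul ?_
      rw [← setLIntegral_const]
      exact lintegral_mono_ae (hv R hR hRQ)
    refine (mul_le_mul_left h2 _).trans (le_of_eq ?_)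
    rw [mul_assoc, ← ENNReal.rpow_add _ _ h0 ht]
    simp [ENNReal.coe_rpow_of_nonneg _ hq1.le]
  · refine lt_of_le_of_lt (lintegral_mono_ae ?_) hwI
    filter_upwards [hfw, hwpos] with x hx hxpos
    have hw0 : ENNReal.ofReal (w x) ≠ 0 := by simpa
    have h1 : ‖f x‖ₑ ^ r ≤ ENNReal.ofReal (w x) := by
      rw [← ofReal_norm, ENNReal.ofReal_rpow_of_nonneg (norm_nonneg _) hr.le]
      exact ENNReal.ofReal_le_ofReal hx
    rw [← hqr, ENNReal.rpow_mul, ← ENNReal.ofReal_rpow_of_pos hxpos]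
    calc _ ≤ ENNReal.ofReal (w x) ^ q * ENNReal.ofReal (w x) ^ (1 - q) :=
          mul_le_mul_left (ENNReal.rpow_le_rpow h1 (by linarith)) _
      _ = ENNReal.ofReal (w x) := by
          rw [← ENNReal.rpow_add _ _ hw0 (by simp)]; simp
end

/-! ### The reverse Hölder inequality on dyadic cubes -/

section
open BoxIntegral
variable {n : ℕ} {σ : (Fin n → ℝ) → ℝ≥0∞} {J : Box (Fin n)} {l : ℝ}

/-- The half-open box `J` is a cube with side `l > 0`. -/
def HasSide (J : Box (Fin n)) (l : ℝ) : Prop :=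
  0 < l ∧ ∀ i, J.upper i - J.lower i = l

lemma HasSide.splitCenterBox (hJ : HasSide J l) (s : Set (Fin n)) :
    HasSide (J.splitCenterBox s) (l / 2) :=
  ⟨half_pos hJ.1, fun i => by rw [Box.upper_sub_lower_splitCenterBox, hJ.2]⟩

lemma HasSide.Icc_eq (hJ : HasSide J l) :
    Box.Icc J = Icc J.lower (fun i => J.lower i + l) := by
  rw [Box.Icc_def]
  congr 1
  funext i
  linarith [hJ.2 i]

lemma HasSide.isCube (hJ : HasSide J l) : IsCube (Box.Icc J) :=
  ⟨J.lower, l, hJ.1, hJ.Icc_eq⟩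

lemma HasSide.volume_eq (hJ : HasSide J l) :
    volume (J : Set (Fin n → ℝ)) = ENNReal.ofReal l ^ n := by
  rw [measure_congr (Box.coe_ae_eq_Icc J), Box.Icc_def, Real.volume_Icc_pi]
  simp [hJ.2]

lemma HasSide.volume_ne_zero (hJ : HasSide J l) : volume (J : Set (Fin n → ℝ)) ≠ 0 := by
  rw [hJ.volume_eq]
  exact pow_ne_zero _ (by simpa using hJ.1)

lemma volume_box_ne_top (J : Box (Fin n)) : volume (J : Set (Fin n → ℝ)) ≠ ∞ :=
  (J.measure_coe_lt_top volume).ne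

lemma HasSide.volume_splitCenterBox (hJ : HasSide J l) (s : Set (Fin n)) :
    2 ^ n * volume (J.splitCenterBox s : Set (Fin n → ℝ)) = volume (J : Set (Fin n → ℝ)) := by
  rw [hJ.volume_eq, (hJ.splitCenterBox s).volume_eq, ← mul_pow,
    ENNReal.ofReal_div_of_pos zero_lt_two, ENNReal.ofReal_ofNat,
    ENNReal.mul_div_cancel (by simp) (by simp)]

lemma setLIntegral_eq_sum_splitCenterBox (f : (Fin n → ℝ) → ℝ≥0∞) (J : Box (Fin n)) :
    ∫⁻ x in J, f x = ∑ s : Set (Fin n), ∫⁻ x in J.splitCenterBox s, f x := by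
  rw [← J.iUnion_coe_splitCenterBox, lintegral_iUnion (fun s => (Box.measurableSet_coe _))
    (fun s t h => J.disjoint_splitCenterBox h), tsum_fintype]

/-- The average of `σ` over the box `J`. -/
noncomputable def boxAvg (σ : (Fin n → ℝ) → ℝ≥0∞) (J : Box (Fin n)) : ℝ≥0∞ :=
  (∫⁻ x in J, σ x) / volume (J : Set (Fin n → ℝ))

lemma HasSide.boxAvg_mul_volume (hJ : HasSide J l) :
    boxAvg σ J * volume (J : Set (Fin n → ℝ)) = ∫⁻ x in J, σ x :=
  ENNReal.div_mul_cancel hJ.volume_ne_zero (volume_box_ne_top J)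

lemma HasSide.boxAvg_splitCenterBox_le (hJ : HasSide J l) (s : Set (Fin n)) :
    boxAvg σ (J.splitCenterBox s) ≤ 2 ^ n * boxAvg σ J := by
  rw [boxAvg, boxAvg, ← hJ.volume_splitCenterBox s, ← mul_div_assoc,
    ENNReal.mul_div_mul_left _ _ (by simp) (by simp)]
  exact ENNReal.div_le_div_right (lintegral_mono_set (J.splitCenterBox_le s)) _

/-- On `J`, the step function whose value on each dyadic subcube of `J` of generation `N` is the
average of `σ` over it; off `J` the values play no role. -/
noncomputable def dyadicAvg (σ : (Fin n → ℝ) → ℝ≥0∞) : ℕ → Box (Fin n) → (Fin n → ℝ) → ℝ≥0∞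
  | 0, J => fun _ => boxAvg σ J
  | N + 1, J => fun x => ∑ s : Set (Fin n),
      (J.splitCenterBox s : Set (Fin n → ℝ)).indicator (dyadicAvg σ N (J.splitCenterBox s)) x

lemma measurable_dyadicAvg (σ : (Fin n → ℝ) → ℝ≥0∞) :
    ∀ (N : ℕ) (J : Box (Fin n)), Measurable (dyadicAvg σ N J)
  | 0, _ => measurable_const
  | N + 1, _ => Finset.measurable_fun_sum _ fun _ _ =>
      (measurable_dyadicAvg σ N _).indicator (Box.measurableSet_coe _)

lemma dyadicAvg_succ_of_mem (N : ℕ) {s : Set (Fin n)} {x : Fin n → ℝ}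
    (hx : x ∈ J.splitCenterBox s) :
    dyadicAvg σ (N + 1) J x = dyadicAvg σ N (J.splitCenterBox s) x := by
  simp only [dyadicAvg]
  rw [Finset.sum_eq_single s]
  · rw [indicator_of_mem (by exact hx)]
  · intro t _ hts
    exact indicator_of_notMem (fun hxt => (J.disjoint_splitCenterBox hts).ne_of_mem hxt hx rfl) _
  · simp

lemma exists_dyadicAvg_eq (N : ℕ) {x : Fin n → ℝ} (hJ : HasSide J l) (hx : x ∈ J) :
    ∃ K ≤ J, x ∈ K ∧ HasSide K (l / 2 ^ N) ∧ dyadicAvg σ N J x = boxAvg σ K := by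
  induction N generalizing J l with
  | zero => exact ⟨J, le_rfl, hx, by simpa using hJ, rfl⟩
  | succ N ih =>
    obtain ⟨s, hs⟩ := Box.exists_mem_splitCenterBox.2 hx
    obtain ⟨K, hK, hxK, hside, he⟩ := ih (hJ.splitCenterBox s) hs
    refine ⟨K, hK.trans (J.splitCenterBox_le s), hxK, ?_, ?_⟩
    · rwa [pow_succ', ← div_div]
    · rw [dyadicAvg_succ_of_mem N hs, he]

lemma lintegral_dyadicAvg_succ (p : ℝ) (N : ℕ) (J : Box (Fin n)) :
    ∫⁻ x in J, dyadicAvg σ (N + 1) J x ^ p =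
      ∑ s : Set (Fin n), ∫⁻ x in J.splitCenterBox s, dyadicAvg σ N (J.splitCenterBox s) x ^ p := by
  rw [setLIntegral_eq_sum_splitCenterBox]
  refine Finset.sum_congr rfl fun s _ => setLIntegral_congr_fun (Box.measurableSet_coe _) ?_
  intro x hx
  simp only
  rw [dyadicAvg_succ_of_mem N hx]

/-- The reverse Hölder inequality for the dyadic averages of `σ`, uniformly in the generation `N`,
when a subset of at most half of the volume of a cube carries at most the fraction `β` of its
`σ`-mass. The second assertion is the Calderón-Zygmund decomposition at height `t`: `E` is the union
of the maximal dyadic subcubes of `J`, of generation at most `N`, over which the average exceeds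
`t`; these averages are at most `2 ^ n * t`. At height twice the average over `J`, such an `E` fills
at most half of `J`, so that `C` is reproduced by `hC`. Both assertions are
proved together by induction on `N`. -/
theorem lintegral_dyadicAvg_rpow_le {I : Box (Fin n)} (hI : ∫⁻ x in I, σ x ≠ ∞) {β C : ℝ≥0∞}
    {ε : ℝ} (hε : 0 < ε)
    (hβ : ∀ (J : Box (Fin n)) (l : ℝ), J ≤ I → HasSide J l → ∀ E ⊆ (J : Set (Fin n → ℝ)),
      MeasurableSet E → 2 * volume E ≤ volume (J : Set (Fin n → ℝ)) →
      ∫⁻ x in E, σ x ≤ β * ∫⁻ x in J, σ x)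
    (hC1 : 1 ≤ C) (hC : 2 ^ ε + C * (2 ^ n * 2) ^ ε * β ≤ C) (N : ℕ) :
    (∀ (J : Box (Fin n)) (l : ℝ), J ≤ I → HasSide J l →
      ∫⁻ x in J, dyadicAvg σ N J x ^ (1 + ε) ≤ C * boxAvg σ J ^ ε * ∫⁻ x in J, σ x) ∧
    ∀ (t : ℝ≥0∞) (J : Box (Fin n)) (l : ℝ), J ≤ I → HasSide J l → boxAvg σ J ≤ 2 ^ n * t →
      ∃ E ⊆ (J : Set (Fin n → ℝ)), MeasurableSet E ∧ t * volume E ≤ ∫⁻ x in E, σ x ∧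
        ∫⁻ x in J, dyadicAvg σ N J x ^ (1 + ε) ≤
          t ^ ε * (∫⁻ x in J, σ x) + C * (2 ^ n * t) ^ ε * ∫⁻ x in E, σ x := by
  have hzero : ∀ (J : Box (Fin n)) (l : ℝ), HasSide J l →
      ∫⁻ x in J, dyadicAvg σ 0 J x ^ (1 + ε) = boxAvg σ J ^ ε * ∫⁻ x in J, σ x := by
    intro J l hJ
    simp only [dyadicAvg, setLIntegral_const]
    rw [ENNReal.rpow_add_of_nonneg _ _ zero_le_one hε.le, ENNReal.rpow_one,
      ← hJ.boxAvg_mul_volume]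
    ring
  -- When `J` is itself selected, the bound on `J` is the first assertion.
  have hselected : ∀ N, (∀ (J : Box (Fin n)) (l : ℝ), J ≤ I → HasSide J l →
      ∫⁻ x in J, dyadicAvg σ N J x ^ (1 + ε) ≤ C * boxAvg σ J ^ ε * ∫⁻ x in J, σ x) →
      ∀ (t : ℝ≥0∞) (J : Box (Fin n)) (l : ℝ), J ≤ I → HasSide J l → boxAvg σ J ≤ 2 ^ n * t →
      t < boxAvg σ J → ∃ E ⊆ (J : Set (Fin n → ℝ)), MeasurableSet E ∧
        t * volume E ≤ ∫⁻ x in E, σ x ∧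
        ∫⁻ x in J, dyadicAvg σ N J x ^ (1 + ε) ≤
          t ^ ε * (∫⁻ x in J, σ x) + C * (2 ^ n * t) ^ ε * ∫⁻ x in E, σ x := by
    intro N hP t J l hJI hJ hle hlt
    refine ⟨J, subset_rfl, Box.measurableSet_coe _, ?_, ?_⟩
    · rw [← hJ.boxAvg_mul_volume]
      exact mul_le_mul_left hlt.le _
    · refine ((hP J l hJI hJ).trans ?_).trans le_add_self
      exact mul_le_mul_left (mul_le_mul_right (ENNReal.rpow_le_rpow hle hε.le) _) _
  induction N with
  | zero =>
    have hP : ∀ (J : Box (Fin n)) (l : ℝ), J ≤ I → HasSide J l →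
        ∫⁻ x in J, dyadicAvg σ 0 J x ^ (1 + ε) ≤ C * boxAvg σ J ^ ε * ∫⁻ x in J, σ x := by
      intro J l hJI hJ
      rw [hzero J l hJ, mul_assoc]
      exact le_mul_of_one_le_left' hC1
    refine ⟨hP, fun t J l hJI hJ hle => ?_⟩
    rcases lt_or_ge t (boxAvg σ J) with hlt | hge
    · exact hselected 0 hP t J l hJI hJ hle hlt
    · refine ⟨∅, empty_subset _, MeasurableSet.empty, by simp, ?_⟩
      rw [hzero J l hJ]
      exact (mul_le_mul_left (ENNReal.rpow_le_rpow hge hε.le) _).trans le_self_add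
  | succ N ih =>
    obtain ⟨-, ihT⟩ := ih
    -- When `J` is not selected, the selected sets of its `2 ^ n` children are united.
    have hsplit : ∀ (t : ℝ≥0∞) (J : Box (Fin n)) (l : ℝ), J ≤ I → HasSide J l →
        boxAvg σ J ≤ t → ∃ E ⊆ (J : Set (Fin n → ℝ)), MeasurableSet E ∧
        t * volume E ≤ ∫⁻ x in E, σ x ∧
        ∫⁻ x in J, dyadicAvg σ (N + 1) J x ^ (1 + ε) ≤
          t ^ ε * (∫⁻ x in J, σ x) + C * (2 ^ n * t) ^ ε * ∫⁻ x in E, σ x := by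
      intro t J l hJI hJ hle
      choose E hEsub hEm hEt hEle using fun s : Set (Fin n) =>
        ihT t (J.splitCenterBox s) (l / 2) ((J.splitCenterBox_le s).trans hJI)
          (hJ.splitCenterBox s) ((hJ.boxAvg_splitCenterBox_le s).trans (mul_le_mul_right hle _))
      have hdisj : Pairwise (Function.onFun Disjoint E) := fun s t h =>
        (J.disjoint_splitCenterBox h).mono (hEsub s) (hEsub t)
      have hEint : ∫⁻ x in ⋃ s, E s, σ x = ∑ s, ∫⁻ x in E s, σ x := by
        rw [lintegral_iUnion hEm hdisj, tsum_fintype]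
      refine ⟨⋃ s, E s, iUnion_subset fun s => (hEsub s).trans (J.splitCenterBox_le s),
        MeasurableSet.iUnion hEm, ?_, ?_⟩
      · rw [hEint, measure_iUnion hdisj hEm, tsum_fintype, Finset.mul_sum]
        exact Finset.sum_le_sum fun s _ => hEt s
      · rw [hEint, lintegral_dyadicAvg_succ, setLIntegral_eq_sum_splitCenterBox σ J,
          Finset.mul_sum, Finset.mul_sum, ← Finset.sum_add_distrib]
        exact Finset.sum_le_sum fun s _ => hEle s
    have hP : ∀ (J : Box (Fin n)) (l : ℝ), J ≤ I → HasSide J l →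
        ∫⁻ x in J, dyadicAvg σ (N + 1) J x ^ (1 + ε) ≤
          C * boxAvg σ J ^ ε * ∫⁻ x in J, σ x := by
      intro J l hJI hJ
      have hσJ : ∫⁻ x in J, σ x ≠ ∞ := ((lintegral_mono_set hJI).trans_lt hI.lt_top).ne
      have htop : boxAvg σ J ≠ ∞ := ENNReal.div_ne_top hσJ hJ.volume_ne_zero
      obtain ⟨E, hEJ, hEm, hEt, hle⟩ := hsplit (2 * boxAvg σ J) J l hJI hJ
        (le_mul_of_one_le_left' one_le_two)
      have hEσ : ∫⁻ x in E, σ x ≤ β * ∫⁻ x in J, σ x := by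
        rcases eq_or_ne (boxAvg σ J) 0 with h0 | h0
        · refine (lintegral_mono_set hEJ).trans ?_
          rw [← hJ.boxAvg_mul_volume, h0, zero_mul]
          exact zero_le
        · refine hβ J l hJI hJ E hEJ hEm ?_
          have h1 := hEt.trans (lintegral_mono_set hEJ)
          rw [← hJ.boxAvg_mul_volume, mul_comm 2, mul_assoc] at h1
          exact (ENNReal.mul_le_mul_iff_right h0 htop).1 h1
      calc _ ≤ (2 * boxAvg σ J) ^ ε * (∫⁻ x in J, σ x) +
            C * (2 ^ n * (2 * boxAvg σ J)) ^ ε * (β * ∫⁻ x in J, σ x) :=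
            hle.trans (add_le_add_right (mul_le_mul_right hEσ _) _)
        _ = (2 ^ ε + C * (2 ^ n * 2) ^ ε * β) * (boxAvg σ J ^ ε * ∫⁻ x in J, σ x) := by
            rw [← mul_assoc (2 ^ n) 2, ENNReal.mul_rpow_of_nonneg _ _ hε.le,
              ENNReal.mul_rpow_of_nonneg (2 ^ n * 2) _ hε.le]
            ring
        _ ≤ C * (boxAvg σ J ^ ε * ∫⁻ x in J, σ x) := mul_le_mul_left hC _
        _ = _ := by ring
    refine ⟨hP, fun t J l hJI hJ hle => ?_⟩
    rcases lt_or_ge t (boxAvg σ J) with hlt | hge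
    · exact hselected (N + 1) hP t J l hJI hJ hle hlt
    · exact hsplit t J l hJI hJ hge

/-- Lebesgue differentiation along dyadic cubes: up to null sets they are closed balls of the sup
norm that contain the point, though not as their centre. -/
theorem ae_tendsto_dyadicAvg (hJ : HasSide J l)
    (hσ : AEMeasurable σ (volume.restrict (J : Set (Fin n → ℝ)))) (hJσ : ∫⁻ x in J, σ x ≠ ∞) :
    ∀ᵐ x ∂(volume.restrict (J : Set (Fin n → ℝ))),
      Filter.Tendsto (fun N => dyadicAvg σ N J x) Filter.atTop (nhds (σ x)) := by
  have hJm : MeasurableSet (J : Set (Fin n → ℝ)) := Box.measurableSet_coe J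
  set f := (J : Set (Fin n → ℝ)).indicator σ with hf
  have hfm : AEMeasurable f volume := (aemeasurable_indicator_iff hJm).2 hσ
  have hfi : ∫⁻ x, f x ≠ ∞ := by rwa [hf, lintegral_indicator hJm]
  filter_upwards [ae_restrict_of_ae ((IsUnifLocDoublingMeasure.vitaliFamily
    (volume : Measure (Fin n → ℝ)) 1).ae_tendsto_lintegral_div hfm hfi), ae_restrict_mem hJm]
    with x hx hxJ
  choose K hKJ hxK hKs hKe using fun N => exists_dyadicAvg_eq (σ := σ) N hJ hxJ
  have hball : ∀ N, Box.Icc (K N) =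
      Metric.closedBall (fun i => (K N).lower i + l / 2 ^ N / 2) (l / 2 ^ N / 2) := fun N => by
    rw [(hKs N).Icc_eq, Icc_add_const_eq_closedBall _ (hKs N).1.le]
  have hδ : Filter.Tendsto (fun N : ℕ => l / 2 ^ N / 2) Filter.atTop
      (nhdsWithin 0 (Ioi 0)) := by
    refine tendsto_nhdsWithin_iff.2 ⟨?_, Filter.Eventually.of_forall fun N => half_pos (hKs N).1⟩
    have h := ((tendsto_pow_atTop_nhds_zero_of_lt_one (r := (2⁻¹ : ℝ)) (by norm_num)
      (by norm_num)).const_mul l).div_const 2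
    simpa [div_eq_mul_inv] using h
  have h := hx.comp (IsUnifLocDoublingMeasure.tendsto_closedBall_filterAt volume
    (fun N i => (K N).lower i + l / 2 ^ N / 2) _ hδ (K := 1)
    (Filter.Eventually.of_forall fun N => by
      rw [one_mul, ← hball N]
      exact Box.coe_subset_Icc (hxK N)))
  have hfx : f x = σ x := indicator_of_mem (by exact hxJ) _
  rw [hfx] at h
  refine h.congr fun N => ?_
  rw [Function.comp_apply, hKe N, boxAvg, ← hball N, setLIntegral_congr (Box.coe_ae_eq_Icc _).symm,
    ← measure_congr (Box.coe_ae_eq_Icc _)]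
  congr 1
  refine setLIntegral_congr_fun (Box.measurableSet_coe _) fun y hy => ?_
  exact indicator_of_mem (by exact hKJ N hy) _

lemma exists_pos_rpow_mul_lt_one {b β : ℝ} (hb : 0 < b) (hβ : β < 1) :
    ∃ ε : ℝ, 0 < ε ∧ b ^ ε * β < 1 := by
  have h : Filter.Tendsto (fun ε : ℝ => b ^ ε * β) (nhdsWithin 0 (Ioi 0))
      (nhds (b ^ (0 : ℝ) * β)) :=
    (((Real.continuous_const_rpow hb.ne').mul_const β).tendsto 0).mono_left nhdsWithin_le_nhds
  rw [Real.rpow_zero, one_mul] at h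
  obtain ⟨ε, h1, h2⟩ := ((h.eventually_lt_const hβ).and self_mem_nhdsWithin).exists
  exact ⟨ε, h2, h1⟩

/-- Self-improvement of integrability: if small parts of cubes carry a small part of the `σ`-mass,
then `σ` lies in `L^(1 + ε)` for some `ε > 0`. -/
theorem exists_lintegral_rpow_ne_top {I : Box (Fin n)} (hIl : HasSide I l)
    (hσ : AEMeasurable σ (volume.restrict (I : Set (Fin n → ℝ)))) (hI : ∫⁻ x in I, σ x ≠ ∞)
    {β : ℝ≥0} (hβ1 : β < 1)
    (hβ : ∀ (J : Box (Fin n)) (l : ℝ), J ≤ I → HasSide J l → ∀ E ⊆ (J : Set (Fin n → ℝ)),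
      MeasurableSet E → 2 * volume E ≤ volume (J : Set (Fin n → ℝ)) →
      ∫⁻ x in E, σ x ≤ β * ∫⁻ x in J, σ x) :
    ∃ ε : ℝ, 0 < ε ∧ ∫⁻ x in I, σ x ^ (1 + ε) ≠ ∞ := by
  obtain ⟨ε, hε, hθ⟩ := exists_pos_rpow_mul_lt_one (b := 2 ^ n * 2) (β := β) (by positivity)
    (by exact_mod_cast hβ1)
  set θ : ℝ := (2 ^ n * 2) ^ ε * β with hθdef
  have hθ0 : 0 ≤ θ := by positivity
  -- `C` is the solution of `2 ^ ε + C * θ = C`.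
  set C : ℝ := 2 ^ ε / (1 - θ) with hCdef
  have h1θ : 0 < 1 - θ := by linarith
  have hC1 : 1 ≤ C := by
    rw [hCdef, one_le_div h1θ]
    linarith [Real.one_le_rpow (x := 2) one_le_two hε.le]
  have hCeq : 2 ^ ε + C * θ = C := by
    rw [hCdef]; field_simp; ring
  have hCE : (2 : ℝ≥0∞) ^ ε + ENNReal.ofReal C * (2 ^ n * 2) ^ ε * β ≤ ENNReal.ofReal C := by
    refine le_of_eq ?_
    conv_rhs => rw [← hCeq]
    rw [ENNReal.ofReal_add (by positivity) (by positivity), ENNReal.ofReal_mul (by positivity),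
      hθdef, ENNReal.ofReal_mul (by positivity), ← ENNReal.ofReal_rpow_of_pos (by positivity),
      ← ENNReal.ofReal_rpow_of_pos (by positivity), ENNReal.ofReal_mul (by positivity),
      ENNReal.ofReal_pow (by positivity), ENNReal.ofReal_ofNat, ENNReal.ofReal_coe_nnreal,
      mul_assoc]
  refine ⟨ε, hε, ?_⟩
  have hbound : ∀ N, ∫⁻ x in I, dyadicAvg σ N I x ^ (1 + ε) ≤
      ENNReal.ofReal C * boxAvg σ I ^ ε * ∫⁻ x in I, σ x := fun N =>
    (lintegral_dyadicAvg_rpow_le hI hε hβ (by simpa using hC1) hCE N).1 I l le_rfl hIl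
  have htop : ENNReal.ofReal C * boxAvg σ I ^ ε * ∫⁻ x in I, σ x ≠ ∞ :=
    ENNReal.mul_ne_top (ENNReal.mul_ne_top (by simp) (ENNReal.rpow_ne_top_of_nonneg hε.le
      (ENNReal.div_ne_top hI hIl.volume_ne_zero))) hI
  refine ne_top_of_le_ne_top htop ?_
  calc ∫⁻ x in I, σ x ^ (1 + ε)
      = ∫⁻ x in I, Filter.liminf (fun N => dyadicAvg σ N I x ^ (1 + ε)) Filter.atTop := by
        refine lintegral_congr_ae ?_
        filter_upwards [ae_tendsto_dyadicAvg hIl hσ hI] with x hx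
        exact (((ENNReal.continuous_rpow_const.tendsto _).comp hx).liminf_eq).symm
    _ ≤ Filter.liminf (fun N => ∫⁻ x in I, dyadicAvg σ N I x ^ (1 + ε)) Filter.atTop :=
        lintegral_liminf_le fun N => (measurable_dyadicAvg σ N I).pow_const _
    _ ≤ _ := Filter.liminf_le_of_le (by isBoundedDefault) fun b hb => by
        obtain ⟨N, hN⟩ := hb.exists
        exact hN.trans (hbound N)
end

/-! ### Higher integrability of the dual of an `A_q` weight -/

section
open BoxIntegral
variable {n : ℕ} {Q : Set (Fin n → ℝ)}

/-- Hölder's inequality for `1 = w ^ (1 / q) * w ^ (-1 / q)`. -/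
theorem volume_rpow_le_lintegral_mul {α : Type*} [MeasurableSpace α] {μ : Measure α}
    {w : α → ℝ} {q : ℝ} (hq : 1 < q) (hw : AEMeasurable w μ) (hpos : ∀ᵐ x ∂μ, 0 < w x) :
    μ univ ^ q ≤ (∫⁻ x, ENNReal.ofReal (w x) ∂μ) *
      (∫⁻ x, ENNReal.ofReal (w x ^ (-1 / (q - 1))) ∂μ) ^ (q - 1) := by
  have hq0 : 0 < q := by linarith
  have hq1 : 0 < q - 1 := by linarith
  have hconj : q.HolderConjugate (q / (q - 1)) := Real.HolderConjugate.conjExponent hq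
  have hWm : AEMeasurable (fun x => ENNReal.ofReal (w x)) μ := hw.ennreal_ofReal
  have hSm : AEMeasurable (fun x => ENNReal.ofReal (w x ^ (-1 / (q - 1)))) μ :=
    (hw.pow_const _).ennreal_ofReal
  have h := ENNReal.lintegral_mul_le_Lp_mul_Lq μ hconj (hWm.pow_const (1 / q))
    (hSm.pow_const ((q - 1) / q))
  have h1 : ∫⁻ x, ((fun x => ENNReal.ofReal (w x) ^ (1 / q)) *
      fun x => ENNReal.ofReal (w x ^ (-1 / (q - 1))) ^ ((q - 1) / q)) x ∂μ = μ univ := by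
    rw [← lintegral_one]
    refine lintegral_congr_ae ?_
    filter_upwards [hpos] with x hx
    have hx0 : ENNReal.ofReal (w x) ≠ 0 := by simpa
    rw [Pi.mul_apply, ← ENNReal.ofReal_rpow_of_pos hx, ← ENNReal.rpow_mul,
      ← ENNReal.rpow_add _ _ hx0 (by simp)]
    have : 1 / q + -1 / (q - 1) * ((q - 1) / q) = 0 := by field_simp; ring
    rw [this, ENNReal.rpow_zero]
  rw [h1] at h
  have h2 : (q - 1) / q * (q / (q - 1)) = 1 := by field_simp
  simp only [← ENNReal.rpow_mul, h2, one_div_mul_cancel hq0.ne', ENNReal.rpow_one] at h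
  refine (ENNReal.rpow_le_rpow h hq0.le).trans (le_of_eq ?_)
  rw [ENNReal.mul_rpow_of_nonneg _ _ hq0.le, ← ENNReal.rpow_mul, ← ENNReal.rpow_mul,
    one_div_mul_cancel hq0.ne', ENNReal.rpow_one]
  congr 2
  field_simp

/-- The `A_q` condition on a cube with the averages cleared of denominators. -/
lemma ApWeights.lintegral_mul_le {w : (Fin n → ℝ) → ℝ} {q : ℝ} (hq : 1 < q)
    {R : Set (Fin n → ℝ)} (hR : IsCube R) {C : ℝ≥0}
    (hC : (⨍⁻ x in R, ENNReal.ofReal (w x) ∂volume) *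
      (⨍⁻ x in R, ENNReal.ofReal (w x ^ (-1 / (q - 1))) ∂volume) ^ (q - 1) ≤ C) :
    (∫⁻ x in R, ENNReal.ofReal (w x)) *
      (∫⁻ x in R, ENNReal.ofReal (w x ^ (-1 / (q - 1)))) ^ (q - 1) ≤ C * volume R ^ q := by
  have hq1 : 0 < q - 1 := by linarith
  have h0 := hR.volume_ne_zero
  have ht := hR.volume_ne_top
  have hv : volume R ^ q = volume R * volume R ^ (q - 1) := by
    conv_rhs => rw [← ENNReal.rpow_one (volume R), ← ENNReal.rpow_mul, one_mul]
    rw [← ENNReal.rpow_add_of_nonneg _ _ zero_le_one hq1.le]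
    ring_nf
  rw [setLAverage_eq, setLAverage_eq] at hC
  set a := ∫⁻ x in R, ENNReal.ofReal (w x)
  set b := ∫⁻ x in R, ENNReal.ofReal (w x ^ (-1 / (q - 1)))
  calc a * b ^ (q - 1)
      = (a / volume R * volume R) * (b / volume R * volume R) ^ (q - 1) := by
        rw [ENNReal.div_mul_cancel h0 ht, ENNReal.div_mul_cancel h0 ht]
    _ = (a / volume R * (b / volume R) ^ (q - 1)) * volume R ^ q := by
        rw [ENNReal.mul_rpow_of_nonneg _ _ hq1.le, hv]; ring
    _ ≤ _ := mul_le_mul_left hC _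

/-- The integrability of the dual weight is implicit in the `A_q` condition, since the integral of
`w` is not zero. -/
lemma lintegral_dual_ne_top {w : (Fin n → ℝ) → ℝ} {q : ℝ} (hq : 1 < q)
    {R : Set (Fin n → ℝ)} (hR : IsCube R) (hw : IsWeight R w) {C : ℝ≥0}
    (hC : (∫⁻ x in R, ENNReal.ofReal (w x)) *
      (∫⁻ x in R, ENNReal.ofReal (w x ^ (-1 / (q - 1)))) ^ (q - 1) ≤ C * volume R ^ q) :
    ∫⁻ x in R, ENNReal.ofReal (w x ^ (-1 / (q - 1))) ≠ ∞ := by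
  intro h
  rw [h, ENNReal.top_rpow_of_pos (by linarith), ENNReal.mul_top, top_le_iff] at hC
  · exact ENNReal.mul_ne_top (by simp)
      (ENNReal.rpow_ne_top_of_nonneg (by linarith) hR.volume_ne_top) hC
  · exact lintegral_ofReal_ne_zero hw.1.1.aemeasurable hw.2
      (by simpa using hR.volume_ne_zero)

/-- A set that fills at least half of a cube carries a fixed fraction of the mass of the dual
weight. -/
lemma lintegral_dual_le_mul {w : (Fin n → ℝ) → ℝ} {q : ℝ} (hq : 1 < q)
    {R F : Set (Fin n → ℝ)} (hR : IsCube R) (hw : IsWeight R w) {C : ℝ≥0}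
    (hC : (∫⁻ x in R, ENNReal.ofReal (w x)) *
      (∫⁻ x in R, ENNReal.ofReal (w x ^ (-1 / (q - 1)))) ^ (q - 1) ≤ C * volume R ^ q)
    (hF : F ⊆ R) (hvol : volume R ≤ 2 * volume F) :
    ∫⁻ x in R, ENNReal.ofReal (w x ^ (-1 / (q - 1))) ≤
      ((2 ^ q * C) ^ (1 / (q - 1)) : ℝ≥0) * ∫⁻ x in F, ENNReal.ofReal (w x ^ (-1 / (q - 1))) := by
  have hq0 : 0 < q := by linarith
  have hq1 : 0 < q - 1 := by linarith
  have hwF := hw.mono hF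
  set σ := fun x => ENNReal.ofReal (w x ^ (-1 / (q - 1))) with hσ
  have h1 := volume_rpow_le_lintegral_mul hq hwF.1.1.aemeasurable hwF.2
  rw [Measure.restrict_apply_univ] at h1
  have hV0 : volume R ^ q ≠ 0 :=
    (ENNReal.rpow_pos (pos_iff_ne_zero.2 hR.volume_ne_zero) hR.volume_ne_top).ne'
  have hVt : volume R ^ q ≠ ∞ := ENNReal.rpow_ne_top_of_nonneg hq0.le hR.volume_ne_top
  have h2 : volume R ^ q * (∫⁻ x in R, σ x) ^ (q - 1) ≤
      volume R ^ q * (2 ^ q * C * (∫⁻ x in F, σ x) ^ (q - 1)) := by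
    calc volume R ^ q * (∫⁻ x in R, σ x) ^ (q - 1)
        ≤ (2 * volume F) ^ q * (∫⁻ x in R, σ x) ^ (q - 1) :=
          mul_le_mul_left (ENNReal.rpow_le_rpow hvol hq0.le) _
      _ ≤ 2 ^ q * ((∫⁻ x in R, ENNReal.ofReal (w x)) * (∫⁻ x in F, σ x) ^ (q - 1)) *
            (∫⁻ x in R, σ x) ^ (q - 1) := by
          rw [ENNReal.mul_rpow_of_nonneg _ _ hq0.le]
          refine mul_le_mul_left (mul_le_mul_right (h1.trans ?_) _) _
          exact mul_le_mul_left (lintegral_mono_set hF) _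
      _ = 2 ^ q * (∫⁻ x in F, σ x) ^ (q - 1) *
            ((∫⁻ x in R, ENNReal.ofReal (w x)) * (∫⁻ x in R, σ x) ^ (q - 1)) := by ring
      _ ≤ 2 ^ q * (∫⁻ x in F, σ x) ^ (q - 1) * (C * volume R ^ q) := mul_le_mul_right hC _
      _ = _ := by ring
  have h3 := (ENNReal.mul_le_mul_iff_right hV0 hVt).1 h2
  have h4 := ENNReal.rpow_le_rpow h3 (one_div_nonneg.2 hq1.le)
  rw [ENNReal.mul_rpow_of_nonneg _ _ (one_div_nonneg.2 hq1.le), ← ENNReal.rpow_mul,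
    ← ENNReal.rpow_mul, mul_one_div_cancel hq1.ne', ENNReal.rpow_one, ENNReal.rpow_one] at h4
  refine h4.trans (le_of_eq ?_)
  rw [ENNReal.coe_rpow_of_nonneg _ (one_div_nonneg.2 hq1.le), ENNReal.coe_mul,
    ENNReal.coe_rpow_of_nonneg _ hq0.le]
  simp

/-- The dual weight `w ^ (-1 / (q - 1))` of an `A_q(Q)` weight is integrable on `Q` to some power
greater than `1`. -/
theorem exists_lintegral_dual_rpow_ne_top (hQ : IsCube Q) {w : (Fin n → ℝ) → ℝ} {q : ℝ}
    (hq : 1 < q) (hw : w ∈ ApWeights q Q) :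
    ∃ ε : ℝ, 0 < ε ∧
      ∫⁻ x in Q, ENNReal.ofReal (w x ^ (-1 / (q - 1))) ^ (1 + ε) ≠ ∞ := by
  obtain ⟨hwt, C, hC⟩ := hw
  obtain ⟨a, l, hl, rfl⟩ := hQ
  set I : Box (Fin n) := ⟨a, fun i => a i + l, fun i => by linarith⟩ with hIdef
  have hIs : HasSide I l := ⟨hl, fun i => by simp [hIdef]⟩
  have hIcc : Box.Icc I = Icc a (fun i => a i + l) := rfl
  rw [← hIcc] at hwt hC ⊢
  have hAp : ∀ R : Set (Fin n → ℝ), IsCube R → R ⊆ Box.Icc I → _ := fun R hR hRQ =>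
    ApWeights.lintegral_mul_le hq hR (hC R hR hRQ)
  set σ := fun x => ENNReal.ofReal (w x ^ (-1 / (q - 1))) with hσ
  rw [← Measure.restrict_congr_set (Box.coe_ae_eq_Icc I)]
  have hwI : IsWeight (I : Set (Fin n → ℝ)) w := hwt.mono Box.coe_subset_Icc
  have hIfin : ∫⁻ x in Box.Icc I, σ x ≠ ∞ :=
    lintegral_dual_ne_top hq hIs.isCube hwt (hAp _ hIs.isCube subset_rfl)
  have hIfin' : ∫⁻ x in I, σ x ≠ ∞ :=
    ((lintegral_mono_set Box.coe_subset_Icc).trans_lt hIfin.lt_top).ne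
  -- Adding `1` makes `M⁻¹ ≤ 1`, so that the subtraction in `1 - M⁻¹` is not truncated.
  set M : ℝ≥0 := (2 ^ q * C) ^ (1 / (q - 1)) + 1 with hM
  have hM1 : 1 ≤ M := le_add_self
  have hM0 : M ≠ 0 := (zero_lt_one.trans_le hM1).ne'
  refine exists_lintegral_rpow_ne_top (β := 1 - M⁻¹) hIs
    (hwI.1.1.aemeasurable.pow_const _).ennreal_ofReal hIfin' ?_ ?_
  · exact tsub_lt_self zero_lt_one (inv_pos.2 (zero_lt_one.trans_le hM1))
  · intro J l' hJI hJ E hEJ hEm hvol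
    have hJcc : Box.Icc J ⊆ Box.Icc I := Box.le_iff_Icc.1 hJI
    have hJfin : ∫⁻ x in J, σ x ≠ ∞ := ((lintegral_mono_set hJI).trans_lt hIfin'.lt_top).ne
    set F := (J : Set (Fin n → ℝ)) \ E with hF
    have hsum : (∫⁻ x in E, σ x) + ∫⁻ x in F, σ x = ∫⁻ x in J, σ x := by
      rw [hF, ← lintegral_inter_add_sdiff σ (J : Set (Fin n → ℝ)) hEm, inter_eq_right.2 hEJ]
    have hFvol : volume (Box.Icc J) ≤ 2 * volume F := by
      have h1 : volume (J : Set (Fin n → ℝ)) = volume E + volume F := by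
        rw [hF, ← measure_inter_add_sdiff (J : Set (Fin n → ℝ)) hEm, inter_eq_right.2 hEJ]
      have hEfin : volume E ≠ ∞ :=
        ((measure_mono hEJ).trans_lt (volume_box_ne_top J).lt_top).ne
      rw [← measure_congr (Box.coe_ae_eq_Icc J)]
      rw [h1, two_mul] at hvol
      have h2 : volume E ≤ volume F := (ENNReal.add_le_add_iff_left hEfin).1 hvol
      rw [h1, two_mul]
      exact add_le_add_left h2 _
    have hFσ : ∫⁻ x in J, σ x ≤ M * ∫⁻ x in F, σ x := by
      have h1 := lintegral_dual_le_mul hq hJ.isCube (hwt.mono hJcc) (hAp _ hJ.isCube hJcc)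
        (F := F) (sdiff_subset.trans Box.coe_subset_Icc) hFvol
      rw [← Measure.restrict_congr_set (Box.coe_ae_eq_Icc J)] at h1
      refine h1.trans (mul_le_mul_left ?_ _)
      exact_mod_cast (le_self_add : _ ≤ M)
    have hinv : ((M⁻¹ : ℝ≥0) : ℝ≥0∞) * ∫⁻ x in J, σ x ≤ ∫⁻ x in F, σ x := by
      refine (mul_le_mul_right hFσ _).trans (le_of_eq ?_)
      rw [← mul_assoc, ← ENNReal.coe_mul, inv_mul_cancel₀ hM0, ENNReal.coe_one, one_mul]
    refine (ENNReal.add_le_add_iff_right (a := ((M⁻¹ : ℝ≥0) : ℝ≥0∞) * ∫⁻ x in J, σ x)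
      (ENNReal.mul_ne_top (by simp) hJfin)).1 ?_
    rw [← add_mul, ← ENNReal.coe_add, tsub_add_cancel_of_le (inv_le_one_of_one_le₀ hM1),
      ENNReal.coe_one, one_mul]
    exact (add_le_add_right hinv _).trans hsum.le

/-- Young's inequality with the exponents that turn `b ^ q * w` and the power `1 + ε` of the dual
weight into a power of `b` alone; its exponent `(1 + ε) q / (q + ε)` exceeds `1`. -/
lemma rpow_le_add_of_pos {b w q ε : ℝ} (hb : 0 ≤ b) (hw : 0 < w) (hq : 1 < q) (hε : 0 < ε) :
    b ^ ((1 + ε) * q / (q + ε)) ≤ b ^ q * w + (w ^ (-1 / (q - 1))) ^ (1 + ε) := by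
  have hq0 : 0 < q := by linarith
  have hq1 : 0 < q - 1 := by linarith
  have hqε : 0 < q + ε := by linarith
  have hw2 : 0 ≤ (w ^ (-1 / (q - 1))) ^ (1 + ε) := by positivity
  have hbw : 0 ≤ b ^ q * w := by positivity
  -- The two summands agree at `b = w ^ (-κ)`.
  set κ : ℝ := (q + ε) / (q * (q - 1)) with hκ
  rcases le_total b (w ^ (-κ)) with h | h
  · refine le_trans ?_ (le_add_of_nonneg_left hbw)
    refine (Real.rpow_le_rpow hb h (by positivity)).trans (le_of_eq ?_)
    rw [← Real.rpow_mul hw.le, ← Real.rpow_mul hw.le]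
    congr 1
    rw [hκ]
    field_simp
  · refine le_trans ?_ (le_add_of_nonneg_right hw2)
    have hbpos : 0 < b := (Real.rpow_pos_of_pos hw _).trans_le h
    have hδ : 0 ≤ q - (1 + ε) * q / (q + ε) := by
      rw [sub_nonneg, div_le_iff₀ hqε]
      nlinarith
    have h1 := Real.rpow_le_rpow (Real.rpow_nonneg hw.le _) h hδ
    rw [← Real.rpow_mul hw.le] at h1
    have e : -κ * (q - (1 + ε) * q / (q + ε)) = -1 := by
      rw [hκ]; field_simp; ring
    rw [e, Real.rpow_neg_one, Real.rpow_sub hbpos, inv_le_iff_one_le_mul₀ hw, div_mul_eq_mul_div,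
      one_le_div (by positivity)] at h1
    exact h1

/-- A function in `L^{p₀}_w(Q)` with `w ∈ A_{p₀ / r}(Q)` is integrable to a power greater than `r`,
by the higher integrability of the dual weight. -/
theorem WeightedLpSpace_subset_iUnion_LpSpace (𝕜 : Type*) [RCLike 𝕜] (hQ : IsCube Q) {r p₀ : ℝ}
    (hr : 0 < r) (hrp : r < p₀) {w : (Fin n → ℝ) → ℝ} (hw : w ∈ ApWeights (p₀ / r) Q) :
    WeightedLpSpace 𝕜 p₀ w Q ⊆ ⋃ (p : ℝ) (_ : r < p), LpSpace 𝕜 p Q := by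
  rintro f ⟨hfm, hfw⟩
  have hq : 1 < p₀ / r := (one_lt_div hr).2 hrp
  obtain ⟨ε, hε, hfin⟩ := exists_lintegral_dual_rpow_ne_top hQ hq hw
  set q := p₀ / r with hqdef
  have hqr : r * q = p₀ := by rw [hqdef]; field_simp
  set t : ℝ := (1 + ε) * q / (q + ε) with ht
  have ht1 : 1 < t := by
    rw [ht, one_lt_div (by linarith)]
    nlinarith
  have hrt : r < r * t := lt_mul_of_one_lt_right hr ht1
  have hrt0 : 0 < r * t := hr.trans hrt
  refine mem_iUnion₂.2 ⟨r * t, hrt, hfm, ?_⟩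
  rw [eLpNorm_lt_top_iff_lintegral_rpow_enorm_lt_top (by simpa using hrt0) (by simp),
    ENNReal.toReal_ofReal hrt0.le]
  have hSm : AEMeasurable (fun x => ENNReal.ofReal (w x ^ (-1 / (q - 1))) ^ (1 + ε))
      (volume.restrict Q) :=
    ((hw.1.1.1.aemeasurable.pow_const _).ennreal_ofReal).pow_const _
  refine lt_of_le_of_lt (lintegral_mono_ae (g := fun x => ‖f x‖ₑ ^ p₀ * ENNReal.ofReal (w x) +
    ENNReal.ofReal (w x ^ (-1 / (q - 1))) ^ (1 + ε)) ?_) ?_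
  · filter_upwards [hw.1.2] with x hx
    have h := rpow_le_add_of_pos (Real.rpow_nonneg (norm_nonneg (f x)) r) hx hq hε
    rw [← ht, ← Real.rpow_mul (norm_nonneg _), ← Real.rpow_mul (norm_nonneg _), hqr] at h
    rw [← ofReal_norm, ENNReal.ofReal_rpow_of_nonneg (norm_nonneg _) hrt0.le,
      ENNReal.ofReal_rpow_of_nonneg (norm_nonneg _) (hr.trans hrp).le,
      ENNReal.ofReal_rpow_of_nonneg (by positivity) (by linarith),
      ← ENNReal.ofReal_mul (by positivity), ← ENNReal.ofReal_add (by positivity) (by positivity)]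
    exact ENNReal.ofReal_le_ofReal h
  · rw [lintegral_add_right' _ hSm]
    exact ENNReal.add_lt_top.2 ⟨hfw, hfin.lt_top⟩
end

theorem theorem2 (𝕜 : Type*) [RCLike 𝕜] {n : ℕ} (Q : Set (Fin n → ℝ)) (hQ : IsCube Q)
    (r p₀ : ℝ) (hr : 0 < r) (hrp : r < p₀) :
    A1Majorized 𝕜 r Q = (⋃ (p : ℝ) (_ : r < p), LpSpace 𝕜 p Q) ∧
    (⋃ (p : ℝ) (_ : r < p), LpSpace 𝕜 p Q) =
      ⋃ w ∈ ApWeights (p₀ / r) Q, WeightedLpSpace 𝕜 p₀ w Q := by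
  have h1 : (⋃ (p : ℝ) (_ : r < p), LpSpace 𝕜 p Q) ⊆ A1Majorized 𝕜 r Q :=
    iUnion₂_subset fun p hp => LpSpace_subset_A1Majorized 𝕜 hQ hr hp
  have h2 := A1Majorized_subset_iUnion_WeightedLpSpace 𝕜 hQ hr hrp
  have h3 : (⋃ w ∈ ApWeights (p₀ / r) Q, WeightedLpSpace 𝕜 p₀ w Q) ⊆
      ⋃ (p : ℝ) (_ : r < p), LpSpace 𝕜 p Q :=
    iUnion₂_subset fun w hw => WeightedLpSpace_subset_iUnion_LpSpace 𝕜 hQ hr hrp hw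
  exact ⟨(h2.trans h3).antisymm h1, (h1.trans h2).antisymm h3⟩
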